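/- Conventions. A subcategory of an abelian category $\mathcal A$ means a full subcategory closed under isomorphisms. A pair $(\mathcal T,\mathcal F)$ of subcategories is a torsion pair if $\mathrm{Hom}(T,F)=0$ for all $T\in\mathcal T$, $F\in\mathcal F$, and each $A\in\mathcal A$ admits a short exact sequence $0\to T\to A\to F\to 0$ with $T\in\mathcal T$, $F\in\mathcal F$; it is hereditary if $\mathcal T$ is closed under subobjects. A subcategory $\mathcal F$ is a torsionfree class if $(\mathcal T,\mathcal F)$ is a torsion pair for some subcategory $\mathcal T$. A Serre subcategory is a nonempty subcategory closed under subobjects, quotient objects and extensions. A finite or infinite sequence of functors $(\dots,F_1,F_0,F_{-1},\dots)$ is an adjoint sequence if each $F_{j}$ is left adjoint to $F_{j-1}$. For $m,n\in\mathbb N_0\cup\{+\infty\}$, a Serre subcategory $\mathcal S$ of $\mathcal A$, with inclusion functor $i:\mathcal S\to\mathcal A$ and quotient functor $Q:\mathcal A\to\mathcal A/\mathcal S$, is of type $(m,-n)$ if there are adjoint sequences $$(F_m,\dots,F_1,F_0=i,F_{-1},\dots,F_{-n})\quad\text{and}\quad(G_m,\dots,G_1,G_0=Q,G_{-1},\dots,G_{-n})$$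 such that $F_m$ and $G_m$ do not both have left adjoints, and $F_{-n}$ and $G_{-n}$ do not both have right adjoints (no condition is imposed at an infinite end). Lemma. Let $\mathcal A$ be a Grothendieck category, and let $\mathcal T,\mathcal G,\mathcal F$ be subcategories of $\mathcal A$ such that $(\mathcal T,\mathcal G)$ and $(\mathcal G,\mathcal F)$ are hereditary torsion pairs in $\mathcal A$ and $\mathcal T$ is not a torsionfree class. Then $\mathcal T$ is a Serre subcategory of type $(0,-2)$, and $\mathcal G$ is a Serre subcategory of type $(1,-1)$. -/

import Mathlib

open CategoryTheory

universe w v u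

namespace SerreType

section TorsionPairs

variable {A : Type u} [Category.{v} A] [Abelian A]

/-- A torsion pair `(T, F)` of full subcategories (closed under isomorphisms) of an abelian
category: there are no nonzero morphisms from `T` to `F`, and every object `X` sits in a short
exact sequence `0 ⟶ X₁ ⟶ X ⟶ X₂ ⟶ 0` with `X₁` in `T` and `X₂` in `F`. -/
structure IsTorsionPair (T F : ObjectProperty A) : Prop where
  left_closedUnderIso : T.IsClosedUnderIsomorphisms
  right_closedUnderIso : F.IsClosedUnderIsomorphisms
  hom_eq_zero : ∀ ⦃X Y : A⦄, T X → F Y → ∀ f : X ⟶ Y, f = 0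
  exists_shortExact : ∀ X : A, ∃ (X₁ X₂ : A) (a : X₁ ⟶ X) (b : X ⟶ X₂) (zero : a ≫ b = 0),
    (ShortComplex.mk a b zero).ShortExact ∧ T X₁ ∧ F X₂

/-- A torsion pair `(T, F)` is hereditary if `T` is closed under subobjects. -/
structure IsHereditaryTorsionPair (T F : ObjectProperty A) : Prop
    extends IsTorsionPair T F where
  closedUnderSubobjects : T.IsClosedUnderSubobjects

/-- `F` is a torsionfree class if it is the second member of some torsion pair. -/
def IsTorsionfreeClass (F : ObjectProperty A) : Prop :=
  ∃ T : ObjectProperty A, IsTorsionPair T F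

end TorsionPairs

/-- The integers `k` with `-n ≤ k ≤ m`, where `m` and `n` are in `ℕ ∪ {∞}`. -/
def InRange (m n : ℕ∞) (k : ℤ) : Prop :=
  (k.toNat : ℕ∞) ≤ m ∧ ((-k).toNat : ℕ∞) ≤ n

lemma inRange_two_mul_zero (m n : ℕ∞) : InRange m n (2 * 0) := by
  simp [InRange]

/-- An adjoint sequence `(F_m, …, F_1, F_0 = F, F_{-1}, …, F_{-n})`, infinite to the left if
`m = ∞` and infinite to the right if `n = ∞`: each `F_{j+1}` is left adjoint to `F_j`.
The functors alternate in direction: `even k` is `F_{2k}`, `odd k` is `F_{2k+1}`, and they are only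
given for indices in the range `[-n, m]`. (When `F` is an additive functor between additive
categories, all the functors are automatically additive, being adjoint to additive functors.) -/
structure AdjointSequence {C D : Type*} [Category* C] [Category* D] (F : C ⥤ D) (m n : ℕ∞) where
  even (k : ℤ) (h : InRange m n (2 * k)) : C ⥤ D
  odd (k : ℤ) (h : InRange m n (2 * k + 1)) : D ⥤ C
  even_zero : even 0 (inRange_two_mul_zero m n) = F
  adjOddEven (k : ℤ) (h₁ : InRange m n (2 * k + 1)) (h₀ : InRange m n (2 * k)) :
    odd k h₁ ⊣ even k h₀
  adjEvenOdd (k : ℤ) (h₁ : InRange m n (2 * (k + 1))) (h₀ : InRange m n (2 * k + 1)) :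
    even (k + 1) h₁ ⊣ odd k h₀

namespace AdjointSequence

variable {C D : Type*} [Category* C] [Category* D] {F : C ⥤ D} {m n : ℕ∞}

/-- The member `F_j` of the sequence has a left adjoint. -/
def HasLeftAdjointAt (S : AdjointSequence F m n) (j : ℤ) : Prop :=
  (∃ (k : ℤ) (h : InRange m n (2 * k)), 2 * k = j ∧ (S.even k h).IsRightAdjoint) ∨
  (∃ (k : ℤ) (h : InRange m n (2 * k + 1)), 2 * k + 1 = j ∧ (S.odd k h).IsRightAdjoint)

/-- The member `F_j` of the sequence has a right adjoint. -/
def HasRightAdjointAt (S : AdjointSequence F m n) (j : ℤ) : Prop :=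
  (∃ (k : ℤ) (h : InRange m n (2 * k)), 2 * k = j ∧ (S.even k h).IsLeftAdjoint) ∨
  (∃ (k : ℤ) (h : InRange m n (2 * k + 1)), 2 * k + 1 = j ∧ (S.odd k h).IsLeftAdjoint)

end AdjointSequence

/-- `P` is a Serre subcategory of type `(m, -n)`: it is a Serre subcategory, and there are adjoint
sequences `(F_m, …, F_0 = i, …, F_{-n})` and `(G_m, …, G_0 = Q, …, G_{-n})` through the inclusion
`i` of `P` and the quotient functor `Q : A ⥤ A/P` (the localization at the morphisms whose kernel
and cokernel are in `P`), such that `F_m` and `G_m` do not both have left adjoints and `F_{-n}`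
and `G_{-n}` do not both have right adjoints. There is no condition at an infinite end. -/
def IsSerreSubcategoryOfType {A : Type u} [Category.{v} A] [Abelian A]
    (P : ObjectProperty A) (m n : ℕ∞) : Prop :=
  ∃ _ : P.IsSerreClass,
  ∃ (F : AdjointSequence P.ι m n) (G : AdjointSequence P.isoModSerre.Q m n),
    (∀ j : ℕ, m = j → ¬ (F.HasLeftAdjointAt j ∧ G.HasLeftAdjointAt j)) ∧
    (∀ j : ℕ, n = j → ¬ (F.HasRightAdjointAt (-j) ∧ G.HasRightAdjointAt (-j)))

end SerreType

open SerreType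

/-! Write `t` for the coreflector onto `T`, and `l`, `g` for the reflector and coreflector of `G`.
Since `G` is Serre, the maps inverted by `A ⥤ A/T` are exactly the `G`-local ones
(`isoModSerre_left_eq_isLocal`), and those inverted by `A ⥤ A/G` are exactly the `T`-colocal ones
(`isoModSerre_right_eq_isColocal`). So `l` and `t` are models of the two quotient functors, and up
to equivalence the same two sequences serve both classes: `(T.ι, t, r)` and `(l, G.ι, g)`. The
functor `r` exists because `t`, being a Serre quotient, preserves finite colimits, and it preserves
coproducts because `G` is closed under them; the special adjoint functor theorem applies. Neither
sequence's outer end at `T.ι` or `g` extends. A left adjoint of `T.ι` would make `T` torsionfree. A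
right adjoint of `g` would make `F` closed under quotients, forcing `T = F`, again torsionfree. -/

open Limits

namespace SerreType

/-! ### Orthogonality, closure properties and adjoints for torsion pairs. -/

section TorsionPairs

variable {A : Type u} [Category.{v} A] [Abelian A] {T F : ObjectProperty A}

namespace IsTorsionPair

variable (h : IsTorsionPair T F)
include h

lemma left_iff {X : A} : T X ↔ ∀ Y, F Y → ∀ f : X ⟶ Y, f = 0 := by
  refine ⟨fun hX Y hY f ↦ h.hom_eq_zero hX hY f, fun hX ↦ ?_⟩
  obtain ⟨X₁, X₂, a, b, zero, hS, h₁, h₂⟩ := h.exists_shortExact X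
  have := hS.mono_f
  have : Epi a := hS.exact.epi_f (hX _ h₂ b)
  have : IsIso a := isIso_of_mono_of_epi a
  have := h.left_closedUnderIso
  exact T.prop_of_iso (asIso a) h₁

lemma right_iff {Y : A} : F Y ↔ ∀ X, T X → ∀ f : X ⟶ Y, f = 0 := by
  refine ⟨fun hY X hX f ↦ h.hom_eq_zero hX hY f, fun hY ↦ ?_⟩
  obtain ⟨X₁, X₂, a, b, zero, hS, h₁, h₂⟩ := h.exists_shortExact Y
  have := hS.epi_g
  have : Mono b := hS.exact.mono_g (hY _ h₁ a)
  have : IsIso b := isIso_of_mono_of_epi b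
  have := h.right_closedUnderIso
  exact F.prop_of_iso (asIso b).symm h₂

lemma left_closedUnderQuotients : T.IsClosedUnderQuotients where
  prop_of_epi f _ hX := h.left_iff.2 fun Z hZ g ↦ by
    rw [← cancel_epi f, h.hom_eq_zero hX hZ (f ≫ g), comp_zero]

lemma right_closedUnderSubobjects : F.IsClosedUnderSubobjects where
  prop_of_mono f _ hY := h.right_iff.2 fun Z hZ g ↦ by
    rw [← cancel_mono f, h.hom_eq_zero hZ hY (g ≫ f), zero_comp]

lemma left_closedUnderExtensions : T.IsClosedUnderExtensions where
  prop_X₂_of_shortExact {S} hS h₁ h₃ := h.left_iff.2 fun Z hZ f ↦ by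
    have := hS.epi_g
    rw [← hS.exact.g_desc f (h.hom_eq_zero h₁ hZ _), h.hom_eq_zero h₃ hZ (hS.exact.desc _ _),
      comp_zero]

lemma left_containsZero : T.ContainsZero :=
  open ZeroObject in
  ⟨_, isZero_zero A, h.left_iff.2 fun _ _ _ ↦ (isZero_zero A).eq_of_src _ _⟩

lemma isZero_of_left_of_right {X : A} (hT : T X) (hF : F X) : IsZero X :=
  (IsZero.iff_id_eq_zero X).2 (h.hom_eq_zero hT hF _)

lemma isLeftAdjoint_ι : T.ι.IsLeftAdjoint := by
  have (X : A) : HasTerminal (CostructuredArrow T.ι X) := by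
    obtain ⟨X₁, X₂, a, b, zero, hS, h₁, h₂⟩ := h.exists_shortExact X
    have : Mono a := hS.mono_f
    let Y : CostructuredArrow T.ι X := CostructuredArrow.mk (S := T.ι) (Y := ⟨X₁, h₁⟩) 
      (show T.ι.obj ⟨X₁, h₁⟩ ⟶ X from a)
    let l (Z : CostructuredArrow T.ι X) : Z.left.obj ⟶ X₁ :=
      hS.exact.lift Z.hom (h.hom_eq_zero Z.left.property h₂ _)
    refine (IsTerminal.ofUniqueHom (Y := Y)
      (fun Z ↦ CostructuredArrow.homMk (ObjectProperty.homMk (l Z))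
        (show l Z ≫ a = Z.hom from hS.exact.lift_f _ _))
      (fun Z m ↦ ?_)).hasTerminal
    ext
    rw [← cancel_mono a]
    exact (CostructuredArrow.w m).trans (hS.exact.lift_f _ _).symm
  exact isLeftAdjoint_of_costructuredArrowTerminals _

lemma isRightAdjoint_ι : F.ι.IsRightAdjoint := by
  have (X : A) : HasInitial (StructuredArrow X F.ι) := by
    obtain ⟨X₁, X₂, a, b, zero, hS, h₁, h₂⟩ := h.exists_shortExact X
    have : Epi b := hS.epi_g
    let Y : StructuredArrow X F.ι := StructuredArrow.mk (T := F.ι) (Y := ⟨X₂, h₂⟩)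
      (show X ⟶ F.ι.obj ⟨X₂, h₂⟩ from b)
    let d (Z : StructuredArrow X F.ι) : X₂ ⟶ Z.right.obj :=
      hS.exact.desc Z.hom (h.hom_eq_zero h₁ Z.right.property _)
    refine (IsInitial.ofUniqueHom (X := Y)
      (fun Z ↦ StructuredArrow.homMk (ObjectProperty.homMk (d Z))
        (show b ≫ d Z = Z.hom from hS.exact.g_desc _ _))
      (fun Z m ↦ ?_)).hasInitial
    ext
    rw [← cancel_epi b]
    exact (StructuredArrow.w m).trans (hS.exact.g_desc _ _).symm
  exact isRightAdjointOfStructuredArrowInitials _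

end IsTorsionPair

lemma IsHereditaryTorsionPair.isSerreClass (h : IsHereditaryTorsionPair T F) :
    T.IsSerreClass where
  __ := h.left_containsZero
  __ := h.closedUnderSubobjects
  __ := h.left_closedUnderQuotients
  __ := h.left_closedUnderExtensions

end TorsionPairs

/-! ### Serre quotients as (co)localizations. -/

section Localization

variable {A : Type u} [Category.{v} A] [Abelian A] {T G : ObjectProperty A}

namespace IsHereditaryTorsionPair

variable (h : IsHereditaryTorsionPair T G)
include h

/-- A monomorphism with torsionfree source and torsion cokernel splits. -/
lemma exists_retraction [G.IsClosedUnderQuotients] {Z P : A} (m : Z ⟶ P) [Mono m] (hZ : G Z) (hC : T (cokernel m)) :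
    ∃ r : P ⟶ Z, m ≫ r = 𝟙 Z := by
  have := h.closedUnderSubobjects
  have := h.left_closedUnderQuotients
  have := h.right_closedUnderSubobjects
  obtain ⟨P₁, P₂, a, b, zero, hS, h₁, h₂⟩ := h.exists_shortExact P
  have : Mono a := hS.mono_f
  have : Epi b := hS.epi_g
  -- The kernel embeds in both `P₁` and `Z`, so it is torsion and torsionfree; dually, the cokernel
  -- is a quotient of both `cokernel m` and `P₂`.
  have : Mono (m ≫ b) := by
    refine Preadditive.mono_of_kernel_zero (IsZero.eq_of_src ?_ _ _)
    have hk : (kernel.ι (m ≫ b) ≫ m) ≫ b = 0 := by simp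
    refine h.isZero_of_left_of_right ?_ (G.prop_of_mono (kernel.ι (m ≫ b)) hZ)
    have := mono_of_mono_fac (hS.exact.lift_f _ hk)
    exact T.prop_of_mono (hS.exact.lift _ hk) h₁
  have : Epi (m ≫ b) := by
    refine Preadditive.epi_of_cokernel_zero (IsZero.eq_of_tgt ?_ _ _)
    have hk : m ≫ b ≫ cokernel.π (m ≫ b) = 0 := by
      rw [← Category.assoc, cokernel.condition]
    refine h.isZero_of_left_of_right ?_ (G.prop_of_epi (cokernel.π (m ≫ b)) h₂)
    have := epi_of_epi_fac (cokernel.π_desc _ _ hk)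
    exact T.prop_of_epi (cokernel.desc _ _ hk) hC
  have : IsIso (m ≫ b) := isIso_of_mono_of_epi _
  exact ⟨b ≫ inv (m ≫ b), by rw [← Category.assoc, IsIso.hom_inv_id]⟩

/-- An epimorphism with torsion target and torsionfree kernel splits. -/
lemma exists_section [G.IsClosedUnderQuotients] {P Z : A} (p : P ⟶ Z) [Epi p] (hZ : T Z) (hK : G (kernel p)) :
    ∃ s : Z ⟶ P, s ≫ p = 𝟙 Z := by
  have := h.closedUnderSubobjects
  have := h.left_closedUnderQuotients
  have := h.right_closedUnderSubobjects
  obtain ⟨P₁, P₂, a, b, zero, hS, h₁, h₂⟩ := h.exists_shortExact P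
  have : Mono a := hS.mono_f
  have : Epi b := hS.epi_g
  have : Mono (a ≫ p) := by
    refine Preadditive.mono_of_kernel_zero (IsZero.eq_of_src ?_ _ _)
    have hk : (kernel.ι (a ≫ p) ≫ a) ≫ p = 0 := by simp
    refine h.isZero_of_left_of_right (T.prop_of_mono (kernel.ι (a ≫ p)) h₁) ?_
    have := mono_of_mono_fac (kernel.lift_ι _ _ hk)
    exact G.prop_of_mono (kernel.lift _ _ hk) hK
  have : Epi (a ≫ p) := by
    refine Preadditive.epi_of_cokernel_zero (IsZero.eq_of_tgt ?_ _ _)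
    have hk : a ≫ p ≫ cokernel.π (a ≫ p) = 0 := by
      rw [← Category.assoc, cokernel.condition]
    refine h.isZero_of_left_of_right (T.prop_of_epi (cokernel.π (a ≫ p)) hZ) ?_
    have := epi_of_epi_fac (hS.exact.g_desc _ hk)
    exact G.prop_of_epi (hS.exact.desc _ hk) h₂
  have : IsIso (a ≫ p) := isIso_of_mono_of_epi _
  exact ⟨inv (a ≫ p) ≫ a, by rw [Category.assoc, IsIso.inv_hom_id]⟩

lemma isLocal_of_epi [T.IsSerreClass] {X Y : A} (f : X ⟶ Y) [Epi f] (hf : T.isoModSerre f) :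
    G.isLocal f := fun Z hZ ↦ by
  refine ⟨fun g₁ g₂ hg ↦ (cancel_epi f).1 hg, fun g ↦ ?_⟩
  have h₀ := h.hom_eq_zero hf.1 hZ (kernel.ι f ≫ g)
  exact ⟨Abelian.epiDesc f g h₀, Abelian.comp_epiDesc f g h₀⟩

/-- To extend `g` along `f`, push `f` out along `g`: the resulting monomorphism out of `Z` has
torsion cokernel, hence a retraction. -/
lemma isLocal_of_mono [G.IsClosedUnderQuotients] [T.IsSerreClass] {X Y : A} (f : X ⟶ Y) [Mono f] (hf : T.isoModSerre f) :
    G.isLocal f := fun Z hZ ↦ by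
  refine ⟨fun g₁ g₂ hg ↦ ?_, fun g ↦ ?_⟩
  · have h₀ : f ≫ (g₁ - g₂) = 0 := by
      rw [Preadditive.comp_sub, sub_eq_zero]
      exact hg
    rw [← sub_eq_zero, ← cokernel.π_desc f _ h₀, h.hom_eq_zero hf.2 hZ (cokernel.desc f _ h₀),
      comp_zero]
  · obtain ⟨r, hr⟩ := h.exists_retraction (pushout.inl g f) hZ
      (MorphismProperty.pushout_inl (P := T.isoModSerre) g f hf).2
    exact ⟨pushout.inr g f ≫ r, by
      dsimp
      rw [← Category.assoc, ← pushout.condition, Category.assoc, hr, Category.comp_id]⟩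

lemma isColocal_of_epi [G.IsSerreClass] {X Y : A} (f : X ⟶ Y) [Epi f] (hf : G.isoModSerre f) :
    T.isColocal f := fun Z hZ ↦ by
  refine ⟨fun g₁ g₂ hg ↦ ?_, fun g ↦ ?_⟩
  · have h₀ : (g₁ - g₂) ≫ f = 0 := by
      rw [Preadditive.sub_comp, sub_eq_zero]
      exact hg
    rw [← sub_eq_zero, ← kernel.lift_ι f _ h₀, h.hom_eq_zero hZ hf.1 (kernel.lift f _ h₀),
      zero_comp]
  · obtain ⟨s, hs⟩ := h.exists_section (pullback.fst g f) hZ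
      (MorphismProperty.pullback_fst (P := G.isoModSerre) g f hf).1
    exact ⟨s ≫ pullback.snd g f, by
      dsimp
      rw [Category.assoc, ← pullback.condition, ← Category.assoc, hs, Category.id_comp]⟩

lemma isColocal_of_mono [G.IsSerreClass] {X Y : A} (f : X ⟶ Y) [Mono f] (hf : G.isoModSerre f) :
    T.isColocal f := fun Z hZ ↦ by
  refine ⟨fun g₁ g₂ hg ↦ (cancel_mono f).1 hg, fun g ↦ ?_⟩
  have h₀ := h.hom_eq_zero hZ hf.2 (g ≫ cokernel.π f)
  exact ⟨Abelian.monoLift f g h₀, Abelian.monoLift_comp f g h₀⟩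

lemma isoModSerre_left_eq_isLocal [G.IsClosedUnderQuotients] [T.IsSerreClass] : T.isoModSerre = G.isLocal := by
  ext X Y f
  refine ⟨fun hf ↦ ?_, fun hf ↦ ⟨?_, ?_⟩⟩
  · rw [← Abelian.image.fac f]
    exact MorphismProperty.comp_mem _ _ _
      (h.isLocal_of_epi _ (ObjectProperty.monoModSerre.isoModSerre_factorThruImage hf.1))
      (h.isLocal_of_mono _ (ObjectProperty.epiModSerre.isoModSerre_image_ι hf.2))
  -- The torsionfree quotient `b` of `X` factors through `f`, so `kernel f` lies in the torsion part
  -- `X₁`.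
  · obtain ⟨X₁, X₂, a, b, zero, hS, h₁, h₂⟩ := h.exists_shortExact X
    obtain ⟨c, hc⟩ := (hf X₂ h₂).2 b
    dsimp at hc
    have : Mono a := hS.mono_f
    have hk : kernel.ι f ≫ b = 0 := by simp [← hc]
    have := mono_of_mono_fac (hS.exact.lift_f _ hk)
    exact T.prop_of_mono (hS.exact.lift _ hk) h₁
  · refine h.left_iff.2 fun Z hZ g ↦ ?_
    rw [← cancel_epi (cokernel.π f), comp_zero]
    exact (hf Z hZ).1 (by simp)

lemma isoModSerre_right_eq_isColocal [G.IsSerreClass] : G.isoModSerre = T.isColocal := by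
  ext X Y f
  refine ⟨fun hf ↦ ?_, fun hf ↦ ⟨?_, ?_⟩⟩
  · rw [← Abelian.image.fac f]
    exact MorphismProperty.comp_mem _ _ _
      (h.isColocal_of_epi _ (ObjectProperty.monoModSerre.isoModSerre_factorThruImage hf.1))
      (h.isColocal_of_mono _ (ObjectProperty.epiModSerre.isoModSerre_image_ι hf.2))
  · refine h.right_iff.2 fun Z hZ g ↦ ?_
    rw [← cancel_mono (kernel.ι f), zero_comp]
    exact (hf Z hZ).1 (by simp)
  -- The torsion part `Y₁` lifts through `f`, so `cokernel f` is a quotient of `Y₂`.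
  · obtain ⟨Y₁, Y₂, a, b, zero, hS, h₁, h₂⟩ := h.exists_shortExact Y
    obtain ⟨c, hc⟩ := (hf Y₁ h₁).2 a
    dsimp at hc
    have : Epi b := hS.epi_g
    have hk : a ≫ cokernel.π f = 0 := by simp [← hc]
    have := epi_of_epi_fac (hS.exact.g_desc _ hk)
    exact G.prop_of_epi (hS.exact.desc _ hk) h₂

end IsHereditaryTorsionPair

end Localization

/-! ### Models of the quotient functors. -/

section Reflectors

lemma mem_range_ι_obj {C : Type*} [Category* C] (P : ObjectProperty C) :
    (· ∈ Set.range P.ι.obj) = P := by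
  ext X
  exact ⟨fun ⟨Y, hY⟩ ↦ hY ▸ Y.property, fun hX ↦ ⟨⟨X, hX⟩, rfl⟩⟩

variable {A : Type u} [Category.{v} A] [Abelian A] {T G : ObjectProperty A}

/-- The quotient by the torsionfree class is given by the coreflector onto the torsion class. -/
lemma IsHereditaryTorsionPair.isLocalization_coreflector (h : IsHereditaryTorsionPair T G)
    [G.IsSerreClass] {t : A ⥤ T.FullSubcategory} (adj : T.ι ⊣ t) :
    t.IsLocalization G.isoModSerre := by
  have := ObjectProperty.isLocalization_isColocal adj
  rwa [mem_range_ι_obj T, ← h.isoModSerre_right_eq_isColocal] at this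

/-- The quotient by the torsion class is given by the reflector onto the torsionfree class. -/
lemma IsHereditaryTorsionPair.isLocalization_reflector (h : IsHereditaryTorsionPair T G)
    [T.IsSerreClass] [G.IsClosedUnderQuotients] {l : A ⥤ G.FullSubcategory} (adj : l ⊣ G.ι) :
    l.IsLocalization T.isoModSerre := by
  have := ObjectProperty.isLocalization_isLocal adj
  rwa [mem_range_ι_obj G, ← h.isoModSerre_left_eq_isLocal] at this

end Reflectors

/-! ### The coreflector onto `T` has a right adjoint. -/

section Colimits


/-- The special adjoint functor theorem for Grothendieck abelian categories, for an arbitrary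
universe of morphisms. -/
lemma isLeftAdjoint_of_preservesColimitsOfSize {A : Type u} [Category.{v} A] [Abelian A]
    [IsGrothendieckAbelian.{w} A] {D : Type*} [Category* D] [LocallySmall.{w} D]
    (t : A ⥤ D) [PreservesColimitsOfSize.{w, w} t] : t.IsLeftAdjoint := by
  let e₁ := ShrinkHoms.equivalence.{w} A
  let e₂ := ShrinkHoms.equivalence.{w} D
  have : (e₁.inverse ⋙ t ⋙ e₂.functor).IsLeftAdjoint :=
    isLeftAdjoint_of_preservesColimits_of_isSeparating (isSeparator_separator (ShrinkHoms.{u} A)) _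
  let i : e₁.functor ⋙ (e₁.inverse ⋙ t ⋙ e₂.functor) ⋙ e₂.inverse ≅ t :=
    (Functor.associator _ _ _).symm ≪≫
    Functor.isoWhiskerRight (e₁.funInvIdAssoc (t ⋙ e₂.functor)) e₂.inverse ≪≫
    Functor.associator _ _ _ ≪≫ Functor.isoWhiskerLeft t e₂.unitIso.symm ≪≫ t.rightUnitor
  exact Functor.isLeftAdjoint_of_iso i

section

variable {A : Type u} [Category.{v} A] [Abelian A] [IsGrothendieckAbelian.{w} A]

lemma mono_sigmaMap {J : Type w} {X Y : J → A} (f : ∀ j, X j ⟶ Y j) [∀ j, Mono (f j)] :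
    Mono (Limits.Sigma.map f) := by
  let φ : Discrete.functor X ⟶ Discrete.functor Y := Discrete.natTrans fun j ↦ f j.as
  have (j : Discrete J) : Mono (φ.app j) := inferInstanceAs (Mono (f j.as))
  have := NatTrans.mono_of_mono_app φ
  exact inferInstanceAs (Mono (colim.map φ))

variable {T G F : ObjectProperty A}

lemma IsTorsionPair.left_sigma (h : IsTorsionPair T G) {J : Type w} {X : J → A}
    (hX : ∀ j, T (X j)) : T (∐ X) :=
  h.left_iff.2 fun Y hY f ↦ Sigma.hom_ext _ _ fun j ↦ by
    rw [h.hom_eq_zero (hX j) hY (Limits.Sigma.ι X j ≫ f), comp_zero]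

variable (hTG : IsHereditaryTorsionPair T G) (hGF : IsHereditaryTorsionPair G F)
  {t : A ⥤ T.FullSubcategory} (adj : T.ι ⊣ t)
include hTG hGF adj

/-- The coproduct `m` of the counits is a monomorphism whose cokernel is in `G`, since `G` is the
left class of `(G, F)`. Hence `m` is `T`-colocal with source in `T`, which identifies that source
with the coreflection of `∐ X`. -/
lemma preservesCoproducts_coreflector (J : Type w) :
    PreservesColimitsOfShape (Discrete J) t := by
  have := hGF.isSerreClass
  have := hTG.closedUnderSubobjects
  have hc (X : A) : T.isColocal (adj.counit.app X) := by
    have := ObjectProperty.isColocal_adj_counit_app adj X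
    rwa [mem_range_ι_obj T] at this
  have hc_mono (X : A) : Mono (adj.counit.app X) := by
    -- The kernel is a subobject of an object of `T`, and colocality makes maps from `T` into the
    -- source determined by their composite with the counit.
    refine Preadditive.mono_of_kernel_zero ((hc X _ ?_).1 (by simp))
    exact T.prop_of_mono (kernel.ι _) (t.obj X).property
  suffices ∀ X : J → A, PreservesColimit (Discrete.functor X) t from
    preservesColimitsOfShape_of_discrete t
  intro X
  let m : ∐ (fun j ↦ (t.obj (X j)).obj) ⟶ ∐ X := Limits.Sigma.map fun j ↦ adj.counit.app (X j)
  have hT : T (∐ fun j ↦ (t.obj (X j)).obj) := hTG.left_sigma fun j ↦ (t.obj (X j)).property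
  have hm : T.isColocal m := by
    rw [← hTG.isoModSerre_right_eq_isColocal]
    have : Mono m := mono_sigmaMap _
    refine G.isoModSerre_of_mono m (hGF.left_iff.2 fun Y hY f ↦ ?_)
    rw [← cancel_epi (cokernel.π m), comp_zero]
    refine Sigma.hom_ext _ _ fun j ↦ ?_
    -- On each summand the map to `Y` kills the image of the counit, so it factors through the
    -- counit's cokernel, an object of `G`.
    have h₀ : adj.counit.app (X j) ≫ Limits.Sigma.ι X j ≫ cokernel.π m ≫ f = 0 := by
      have : adj.counit.app (X j) ≫ Limits.Sigma.ι X j =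
        Limits.Sigma.ι (fun j ↦ (t.obj (X j)).obj) j ≫ m := by simp [m]
      rw [reassoc_of% this]
      simp
    have hG : G.isoModSerre (adj.counit.app (X j)) := by
      rw [hTG.isoModSerre_right_eq_isColocal]
      exact hc _
    rw [comp_zero, ← cokernel.π_desc _ _ h₀, hGF.hom_eq_zero hG.2 hY (cokernel.desc _ _ h₀),
      comp_zero]
  obtain ⟨u, hu⟩ := (hc (∐ X) _ hT).2 m
  dsimp at u hu
  -- By two-out-of-three `u` is `T`-colocal, and a colocal map between objects of `T` is invertible.
  have : IsIso u := by
    rw [← ObjectProperty.isColocal_iff_isIso T u hT (t.obj _).property]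
    exact MorphismProperty.of_postcomp _ _ _ (hc _) (by rwa [hu])
  have hι (j : J) : Limits.Sigma.ι (fun j ↦ (t.obj (X j)).obj) j ≫ u =
      T.ι.map (t.map (Limits.Sigma.ι X j)) := by
    rw [← cancel_mono (adj.counit.app (∐ X)), Category.assoc, hu]
    simpa [m] using (adj.counit.naturality (Limits.Sigma.ι X j)).symm
  refine preservesColimit_of_preserves_colimit_cocone (coproductIsCoproduct X)
    ((isColimitMapCoconeCofanMkEquiv t _ _).symm (isColimitOfReflects T.ι
      ((isColimitMapCoconeCofanMkEquiv T.ι _ _).symm ?_)))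
  exact IsColimit.ofIsoColimit (coproductIsCoproduct fun j ↦ (t.obj (X j)).obj)
    (Cofan.ext (asIso u) hι)

lemma isLeftAdjoint_coreflector : t.IsLeftAdjoint := by
  have := hGF.isSerreClass
  have := hTG.isLocalization_coreflector adj
  have : t.Additive := adj.right_adjoint_additive
  have := ObjectProperty.SerreClassLocalization.preservesFiniteColimits t G
  have := preservesCoproducts_coreflector hTG hGF adj
  have : LocallySmall.{w} T.FullSubcategory := locallySmall_of_faithful T.ι
  have : PreservesColimitsOfSize.{w, w} t :=
    preservesColimits_of_preservesCoequalizers_and_coproducts t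
  exact isLeftAdjoint_of_preservesColimitsOfSize.{w} t

end

end Colimits

/-! ### Why the sequences stop. -/

section Ends

variable {A : Type u} [Category.{v} A] [Abelian A] {T G F : ObjectProperty A}

/-- A reflective Serre subcategory is a torsionfree class. -/
lemma isTorsionfreeClass_of_isRightAdjoint_ι [T.IsSerreClass] [T.ι.IsRightAdjoint] :
    IsTorsionfreeClass T := by
  let adj := Adjunction.ofIsRightAdjoint T.ι
  let η (X : A) : X ⟶ (T.ι.leftAdjoint.obj X).obj := adj.unit.app X
  have fac {X Y : A} (hY : T Y) (f : X ⟶ Y) : ∃ g, η X ≫ g = f := by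
    let f' : X ⟶ T.ι.obj ⟨Y, hY⟩ := f
    exact ⟨T.ι.map ((adj.homEquiv X ⟨Y, hY⟩).symm f'), (adj.homEquiv_unit _ _ _).symm.trans
      ((adj.homEquiv X ⟨Y, hY⟩).apply_symm_apply f')⟩
  let L : ObjectProperty A := fun X ↦ ∀ Y, T Y → ∀ f : X ⟶ Y, f = 0
  refine ⟨L, ⟨fun e hX Y hY f ↦ ?_⟩, inferInstance, fun X Y hX hY f ↦ hX Y hY f, fun X ↦ ?_⟩
  · rw [← cancel_epi e.hom, hX Y hY (e.hom ≫ f), comp_zero]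
  · let k := kernel.ι (η X)
    have hC : T (cokernel k) := T.prop_of_iso (Abelian.coimageIsoImage (η X)).symm
      (T.prop_of_mono (Abelian.image.ι (η X)) (T.ι.leftAdjoint.obj X).property)
    refine ⟨_, _, k, cokernel.π k, cokernel.condition k, ⟨ShortComplex.exact_cokernel k⟩,
      fun Y hY f ↦ ?_, hC⟩
    -- The pushout of `k` along `f` is an extension of `cokernel k` by `Y`, hence in `T`. So
    -- `pushout.inl k f` factors through the unit and kills its kernel `k`; as `pushout.inr k f` is
    -- mono, `f = 0`.
    have hi : T.isoModSerre (pushout.inr k f) :=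
      MorphismProperty.pushout_inr (P := T.isoModSerre) k f (T.isoModSerre_of_mono k hC)
    have hP : T (pushout k f) :=
      T.prop_X₂_of_exact (ShortComplex.exact_cokernel (pushout.inr k f)) hY hi.2
    obtain ⟨p, hp⟩ := fac hP (pushout.inl k f)
    have hk : k ≫ pushout.inl k f = 0 := by rw [← hp, kernel.condition_assoc, zero_comp]
    rw [← cancel_mono (pushout.inr k f), ← pushout.condition, hk, zero_comp]

/-- If the right adjoint of the inclusion of a hereditary torsion class is a left adjoint, then
the torsionfree class is closed under quotients. -/
lemma IsTorsionPair.right_closedUnderQuotients (h : IsTorsionPair G F)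
    {g : A ⥤ G.FullSubcategory} (adj : G.ι ⊣ g) [g.IsLeftAdjoint] :
    F.IsClosedUnderQuotients where
  prop_of_epi {X Y} f _ hX := h.right_iff.2 fun Z hZ k ↦ by
    let Z' : G.FullSubcategory := ⟨Z, hZ⟩
    have h₀ : 𝟙 (g.obj X) = 0 := (adj.homEquiv _ _).symm.injective
      ((h.hom_eq_zero (g.obj X).property hX _).trans
        (h.hom_eq_zero (g.obj X).property hX _).symm)
    -- As a left adjoint `g` preserves epimorphisms, so `g.obj X = 0` forces `g.obj Y = 0`.
    have h₁ : 𝟙 (g.obj Y) = 0 := by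
      rw [← cancel_epi (g.map f), ← Category.id_comp (g.map f), h₀]
      simp
    have h₂ : adj.homEquiv Z' Y k = adj.homEquiv Z' Y 0 := by
      rw [← Category.comp_id (adj.homEquiv Z' Y k), ← Category.comp_id (adj.homEquiv Z' Y 0), h₁]
      simp
    exact (adj.homEquiv Z' Y).injective h₂

/-- Any map from `G` to `T`, or from `F` to `G`, has its image in both classes, hence is zero. -/
lemma IsHereditaryTorsionPair.eq_of_closedUnderQuotients (hTG : IsHereditaryTorsionPair T G)
    (hGF : IsHereditaryTorsionPair G F) [F.IsClosedUnderQuotients] : T = F := by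
  have := hTG.closedUnderSubobjects
  have := hGF.left_closedUnderQuotients
  ext X
  refine ⟨fun hX ↦ ?_, fun hX ↦ ?_⟩
  · refine hGF.right_iff.2 fun Z hZ f ↦ ?_
    have hI : T (Abelian.image f) := T.prop_of_mono (Abelian.image.ι f) hX
    have hI' : G (Abelian.image f) := G.prop_of_epi (Abelian.factorThruImage f) hZ
    rw [← Abelian.image.fac f, (hTG.isZero_of_left_of_right hI hI').eq_of_src
      (Abelian.image.ι f) 0, comp_zero]
  · refine hTG.left_iff.2 fun Z hZ f ↦ ?_
    have := hTG.right_closedUnderSubobjects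
    have hI : F (Abelian.image f) := F.prop_of_epi (Abelian.factorThruImage f) hX
    have hI' : G (Abelian.image f) := G.prop_of_mono (Abelian.image.ι f) hZ
    rw [← Abelian.image.fac f, (hGF.isZero_of_left_of_right hI' hI).eq_of_src
      (Abelian.image.ι f) 0, comp_zero]

end Ends

/-! ### Packaging three-term adjoint sequences. -/

namespace AdjointSequence

variable {C D : Type*} [Category* C] [Category* D]

/-- The adjoint sequence `(F, F₁, F₂)`. -/
def ofTwoRightAdjoints {F F₂ : C ⥤ D} {F₁ : D ⥤ C} (adj₁ : F ⊣ F₁) (adj₂ : F₁ ⊣ F₂) :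
    AdjointSequence F 0 2 where
  -- For `2 * k` in `[-2, 0]` only `k = 0` and `k = -1` occur; the sole odd index is `-1`.
  even k _ := if k = 0 then F else F₂
  odd _ _ := F₁
  even_zero := if_pos rfl
  adjOddEven k h₁ h₀ := by
    have h : k ≠ 0 := by
      rintro rfl
      simp [InRange] at h₁
    exact adj₂.ofNatIsoRight (eqToIso (if_neg h).symm)
  adjEvenOdd k h₁ h₀ := by
    have h : k + 1 = 0 := by
      simp only [InRange, Nat.cast_le_ofNat, nonpos_iff_eq_zero, Nat.cast_eq_zero] at h₀ h₁
      omega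
    exact adj₁.ofNatIsoLeft (eqToIso (if_pos h).symm)

/-- The adjoint sequence `(F₁, F, F₂)`. -/
def ofLeftRightAdjoint {F : C ⥤ D} {F₁ F₂ : D ⥤ C} (adj₁ : F₁ ⊣ F) (adj₂ : F ⊣ F₂) :
    AdjointSequence F 1 1 where
  even _ _ := F
  -- The odd indices in `[-1, 1]` are `1` and `-1`, that is `k = 0` and `k = -1`.
  odd k _ := if k = 0 then F₁ else F₂
  even_zero := rfl
  adjOddEven k h₁ h₀ := by
    have h : k = 0 := by
      simp only [InRange, Nat.cast_le_one] at h₀ h₁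
      omega
    exact adj₁.ofNatIsoLeft (eqToIso (if_pos h).symm)
  adjEvenOdd k h₁ h₀ := by
    have h : k ≠ 0 := by
      rintro rfl
      simp [InRange] at h₁
    exact adj₂.ofNatIsoRight (eqToIso (if_neg h).symm)

lemma isRightAdjoint_of_ofTwoRightAdjoints {F F₂ : C ⥤ D} {F₁ : D ⥤ C} (adj₁ : F ⊣ F₁)
    (adj₂ : F₁ ⊣ F₂) (h : (ofTwoRightAdjoints adj₁ adj₂).HasLeftAdjointAt 0) :
    F.IsRightAdjoint := by
  obtain ⟨k, _, hk, h⟩ | ⟨k, _, hk, h⟩ := h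
  · have : (if k = 0 then F else F₂).IsRightAdjoint := h
    rwa [if_pos (by omega)] at this
  · omega

lemma isLeftAdjoint_of_ofTwoRightAdjoints {F F₂ : C ⥤ D} {F₁ : D ⥤ C} (adj₁ : F ⊣ F₁)
    (adj₂ : F₁ ⊣ F₂) (h : (ofTwoRightAdjoints adj₁ adj₂).HasRightAdjointAt (-2)) :
    F₂.IsLeftAdjoint := by
  obtain ⟨k, _, hk, h⟩ | ⟨k, _, hk, h⟩ := h
  · have : (if k = 0 then F else F₂).IsLeftAdjoint := h
    rwa [if_neg (by omega)] at this
  · omega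

lemma isRightAdjoint_of_ofLeftRightAdjoint {F : C ⥤ D} {F₁ F₂ : D ⥤ C} (adj₁ : F₁ ⊣ F)
    (adj₂ : F ⊣ F₂) (h : (ofLeftRightAdjoint adj₁ adj₂).HasLeftAdjointAt 1) :
    F₁.IsRightAdjoint := by
  obtain ⟨k, _, hk, h⟩ | ⟨k, _, hk, h⟩ := h
  · omega
  · have : (if k = 0 then F₁ else F₂).IsRightAdjoint := h
    rwa [if_pos (by omega)] at this

lemma isLeftAdjoint_of_ofLeftRightAdjoint {F : C ⥤ D} {F₁ F₂ : D ⥤ C} (adj₁ : F₁ ⊣ F)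
    (adj₂ : F ⊣ F₂) (h : (ofLeftRightAdjoint adj₁ adj₂).HasRightAdjointAt (-1)) :
    F₂.IsLeftAdjoint := by
  obtain ⟨k, _, hk, h⟩ | ⟨k, _, hk, h⟩ := h
  · omega
  · have : (if k = 0 then F₁ else F₂).IsLeftAdjoint := h
    rwa [if_neg (by omega)] at this

end AdjointSequence

end SerreType

theorem lemma5p4 {A : Type u} [Category.{v} A] [Abelian A] [IsGrothendieckAbelian.{w} A]
    (T G F : ObjectProperty A)
    (hTG : IsHereditaryTorsionPair T G) (hGF : IsHereditaryTorsionPair G F)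
    (hT : ¬ IsTorsionfreeClass T) :
    IsSerreSubcategoryOfType T 0 2 ∧ IsSerreSubcategoryOfType G 1 1 := by
  have hTs := hTG.isSerreClass
  have hGs := hGF.isSerreClass
  have := hTG.isLeftAdjoint_ι
  have := hTG.isRightAdjoint_ι
  have := hGF.isLeftAdjoint_ι
  let t := T.ι.rightAdjoint
  let adjt : T.ι ⊣ t := Adjunction.ofIsLeftAdjoint T.ι
  let l := G.ι.leftAdjoint
  let adjl : l ⊣ G.ι := Adjunction.ofIsRightAdjoint G.ι
  let g := G.ι.rightAdjoint
  let adjg : G.ι ⊣ g := Adjunction.ofIsLeftAdjoint G.ι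
  have : t.IsLeftAdjoint := isLeftAdjoint_coreflector hTG hGF adjt
  let adjr : t ⊣ t.rightAdjoint := Adjunction.ofIsLeftAdjoint t
  have hT_left : ¬ T.ι.IsRightAdjoint := fun _ ↦ hT isTorsionfreeClass_of_isRightAdjoint_ι
  have hG_right : ¬ g.IsLeftAdjoint := fun _ ↦ hT (by
    have := hGF.right_closedUnderQuotients adjg
    exact ⟨G, hTG.eq_of_closedUnderQuotients hGF ▸ hGF.toIsTorsionPair⟩)
  have := hTG.isLocalization_coreflector adjt
  have := hTG.isLocalization_reflector adjl
  let e := Localization.equivalenceFromModel l T.isoModSerre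
  let ie : l ⋙ e.inverse ≅ T.isoModSerre.Q := Localization.compEquivalenceFromModelInverseIso _ _
  let e' := Localization.equivalenceFromModel t G.isoModSerre
  let ie' : t ⋙ e'.inverse ≅ G.isoModSerre.Q := Localization.compEquivalenceFromModelInverseIso _ _
  refine ⟨⟨hTs, .ofTwoRightAdjoints adjt adjr, .ofTwoRightAdjoints
    ((adjl.comp e.symm.toAdjunction).ofNatIsoLeft ie) (e.toAdjunction.comp adjg), ?_, ?_⟩,
    ⟨hGs, .ofLeftRightAdjoint adjl adjg, .ofLeftRightAdjoint
      ((e'.toAdjunction.comp adjt).ofNatIsoRight ie')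
      ((adjr.comp e'.symm.toAdjunction).ofNatIsoLeft ie'), ?_, ?_⟩⟩
  · intro j hj h
    obtain rfl : 0 = j := by exact_mod_cast hj
    exact hT_left (AdjointSequence.isRightAdjoint_of_ofTwoRightAdjoints _ _ h.1)
  · intro j hj h
    obtain rfl : 2 = j := by exact_mod_cast hj
    have := AdjointSequence.isLeftAdjoint_of_ofTwoRightAdjoints _ _ h.2
    -- The last term is `g ⋙ e.inverse`; composing with the equivalence `e.functor` recovers `g`,
    -- still a left adjoint.
    exact hG_right (Functor.isLeftAdjoint_of_iso
      (Functor.associator _ _ _ ≪≫ Functor.isoWhiskerLeft g e.counitIso ≪≫ g.rightUnitor :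
        (g ⋙ e.inverse) ⋙ e.functor ≅ g))
  · intro j hj h
    obtain rfl : 1 = j := by exact_mod_cast hj
    have := AdjointSequence.isRightAdjoint_of_ofLeftRightAdjoint _ _ h.2
    exact hT_left (Functor.isRightAdjoint_of_iso (e'.invFunIdAssoc T.ι))
  · intro j hj h
    obtain rfl : 1 = j := by exact_mod_cast hj
    exact hG_right (AdjointSequence.isLeftAdjoint_of_ofLeftRightAdjoint _ _ h.1)
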